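/- Let $l\ge 2$ and let $k_1,\dots,k_l\ge 1$ be integers with $k_1+\dots+k_l=n$. Let $\bar X\subseteq(\mathbb P M_n(\mathbb C))^l$ be the set of tuples $([A_1],\dots,[A_l])$ of nonzero complex $n\times n$ matrices up to scalars for which there exist linear subspaces $V_1,\dots,V_l\subseteq\mathbb C^n$ such that, for every $i$, $V_i$ is invariant under $A_i$ (that is, $A_iV_i\subseteq V_i$) and $\dim V_i=k_i$, and such that $V_1+\dots+V_l\neq\mathbb C^n$. Then $\bar X$ is an irreducible projective variety: it is the set of common zeros in $(\mathbb P M_n(\mathbb C))^l$ of a family of polynomials that are homogeneous in the entries of each $A_i$ separately, and, in the Zariski topology (whose closed sets are all such zero sets), it is nonempty and is not the union of two proper closed subsets. -/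

import Mathlib

/-- The multiprojective space `(ℙ M_n(ℂ))^l`. -/
abbrev MatTuple (n l : ℕ) : Type :=
  Fin l → Projectivization ℂ (Matrix (Fin n) (Fin n) ℂ)

/-- Polynomials in the entries of `l` matrices of size `n × n`; the variable `(i, a, b)` is the
entry in row `a` and column `b` of the `i`-th matrix. -/
abbrev EntryPoly (n l : ℕ) : Type :=
  MvPolynomial (Fin l × Fin n × Fin n) ℂ

/-- `f` is multihomogeneous: for some `d : Fin l → ℕ` it is homogeneous of degree `d i` in the
entries of the `i`-th matrix, for every `i`. -/
def IsMultihomogeneous {n l : ℕ} (f : EntryPoly n l) : Prop :=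
  ∃ d : Fin l → ℕ, MvPolynomial.IsWeightedHomogeneous
    (fun x : Fin l × Fin n × Fin n => (Pi.single x.1 1 : Fin l → ℕ)) f d

/-- The polynomial `f` vanishes at all (multi)homogeneous coordinates of the point `p`. -/
def VanishesAt {n l : ℕ} (f : EntryPoly n l) (p : MatTuple n l) : Prop :=
  ∀ A : Fin l → Matrix (Fin n) (Fin n) ℂ,
    (∀ i, ∃ h : A i ≠ 0, Projectivization.mk ℂ (A i) h = p i) →
      MvPolynomial.eval (fun x : Fin l × Fin n × Fin n => A x.1 x.2.1 x.2.2) f = 0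

/-- The common zero set in `(ℙ M_n(ℂ))^l` of a set of polynomials. -/
def multiZeroLocus {n l : ℕ} (S : Set (EntryPoly n l)) : Set (MatTuple n l) :=
  {p | ∀ f ∈ S, VanishesAt f p}

/-- Algebraic subsets of `(ℙ M_n(ℂ))^l`: zero sets of multihomogeneous polynomials. -/
def IsAlgebraicSet {n l : ℕ} (Z : Set (MatTuple n l)) : Prop :=
  ∃ S : Set (EntryPoly n l), (∀ f ∈ S, IsMultihomogeneous f) ∧ Z = multiZeroLocus S

theorem IsMultihomogeneous.eval_smul {n l : ℕ} {f : EntryPoly n l} (hf : IsMultihomogeneous f) :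
    ∃ d : Fin l → ℕ, ∀ (c : Fin l → ℂ) (A : Fin l → Matrix (Fin n) (Fin n) ℂ),
      MvPolynomial.eval (fun x : Fin l × Fin n × Fin n => (c x.1 • A x.1) x.2.1 x.2.2) f =
        (∏ i, c i ^ d i) *
          MvPolynomial.eval (fun x : Fin l × Fin n × Fin n => A x.1 x.2.1 x.2.2) f := by
  obtain ⟨d, hd⟩ := hf
  refine ⟨d, fun c A => ?_⟩
  rw [MvPolynomial.eval_eq', MvPolynomial.eval_eq', Finset.mul_sum]
  refine Finset.sum_congr rfl fun m hm => ?_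
  have hw := hd (MvPolynomial.mem_support_iff.mp hm)
  have key : ∏ x : Fin l × Fin n × Fin n, c x.1 ^ m x = ∏ i, c i ^ d i := by
    rw [Fintype.prod_prod_type]
    refine Finset.prod_congr rfl fun i _ => ?_
    dsimp only
    rw [Finset.prod_pow_eq_pow_sum]
    congr 1
    have := congrFun hw i
    rw [Finsupp.weight_apply, Finsupp.sum_fintype _ _ (by simp), Finset.sum_apply,
      Fintype.sum_prod_type] at this
    rw [← this, Finset.sum_eq_single i]
    · simp
    · intro j _ hj
      simp [Pi.single_apply, hj.symm]
    · simp
  have h2 : ∀ x : Fin l × Fin n × Fin n, ((c x.1 • A x.1) x.2.1 x.2.2) ^ m x =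
      c x.1 ^ m x * (A x.1 x.2.1 x.2.2) ^ m x := by
    intro x
    simp [Matrix.smul_apply, mul_pow]
  simp only [h2]
  rw [Finset.prod_mul_distrib, key]
  ring

/-- For multihomogeneous `f`, vanishing may be tested on one choice of coordinates. -/
theorem IsMultihomogeneous.vanishesAt_iff {n l : ℕ} {f : EntryPoly n l}
    (hf : IsMultihomogeneous f) (p : MatTuple n l) :
    VanishesAt f p ↔
      MvPolynomial.eval (fun x : Fin l × Fin n × Fin n => (p x.1).rep x.2.1 x.2.2) f = 0 := by
  constructor
  · intro h
    exact h (fun i => (p i).rep) fun i => ⟨(p i).rep_nonzero, (p i).mk_rep⟩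
  · intro h A hA
    have h1 : ∀ i, ∃ c : ℂ, c • (p i).rep = A i := by
      intro i
      obtain ⟨h0, h1⟩ := hA i
      rw [← (p i).mk_rep, Projectivization.mk_eq_mk_iff'] at h1
      exact h1
    choose c hc using h1
    obtain ⟨d, hd⟩ := hf.eval_smul
    have := hd c (fun i => (p i).rep)
    simp only [hc] at this
    rw [this, h, mul_zero]

theorem isAlgebraicSet_empty {n l : ℕ} : IsAlgebraicSet (∅ : Set (MatTuple n l)) := by
  have h1 : IsMultihomogeneous (1 : EntryPoly n l) :=
    ⟨0, MvPolynomial.isWeightedHomogeneous_one ℂ _⟩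
  refine ⟨{1}, by simpa using h1, ?_⟩
  ext p
  simp [multiZeroLocus, h1.vanishesAt_iff]

theorem IsAlgebraicSet.sInter {n l : ℕ} {T : Set (Set (MatTuple n l))}
    (hT : ∀ Z ∈ T, IsAlgebraicSet Z) : IsAlgebraicSet (⋂₀ T) := by
  choose! S hS hZ using hT
  refine ⟨⋃ Z ∈ T, S Z, ?_, ?_⟩
  · intro f hf
    simp only [Set.mem_iUnion] at hf
    obtain ⟨Z, hZT, hfZ⟩ := hf
    exact hS Z hZT f hfZ
  · ext p
    simp only [Set.mem_sInter, multiZeroLocus, Set.mem_iUnion, Set.mem_ofPred_eq]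
    constructor
    · rintro h f ⟨Z, hZT, hfZ⟩
      have := h Z hZT
      rw [hZ Z hZT] at this
      exact this f hfZ
    · intro h Z hZT
      rw [hZ Z hZT]
      exact fun f hf => h f ⟨Z, hZT, hf⟩

theorem IsMultihomogeneous.mul {n l : ℕ} {f g : EntryPoly n l}
    (hf : IsMultihomogeneous f) (hg : IsMultihomogeneous g) : IsMultihomogeneous (f * g) := by
  obtain ⟨d, hd⟩ := hf
  obtain ⟨e, he⟩ := hg
  exact ⟨d + e, hd.mul he⟩

theorem IsAlgebraicSet.union {n l : ℕ} {Y Z : Set (MatTuple n l)}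
    (hY : IsAlgebraicSet Y) (hZ : IsAlgebraicSet Z) : IsAlgebraicSet (Y ∪ Z) := by
  obtain ⟨S, hS, rfl⟩ := hY
  obtain ⟨T, hT, rfl⟩ := hZ
  refine ⟨{h | ∃ f ∈ S, ∃ g ∈ T, h = f * g}, ?_, ?_⟩
  · rintro h ⟨f, hf, g, hg, rfl⟩
    exact (hS f hf).mul (hT g hg)
  · ext p
    constructor
    · rintro (h | h) _ ⟨f, hf, g, hg, rfl⟩ A hA
      · rw [map_mul, h f hf A hA, zero_mul]
      · rw [map_mul, h g hg A hA, mul_zero]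
    · intro h
      by_contra hc
      simp only [Set.mem_union, not_or, multiZeroLocus, Set.mem_ofPred_eq, not_forall] at hc
      obtain ⟨⟨f, hf, hfp⟩, ⟨g, hg, hgp⟩⟩ := hc
      have := h (f * g) ⟨f, hf, g, hg, rfl⟩
      rw [((hS f hf).mul (hT g hg)).vanishesAt_iff, map_mul, mul_eq_zero] at this
      rw [(hS f hf).vanishesAt_iff] at hfp
      rw [(hT g hg).vanishesAt_iff] at hgp
      exact this.elim hfp hgp

/-- The Zariski topology on `(ℙ M_n(ℂ))^l`: the closed sets are the zero sets of multihomogeneous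
polynomials. (This is not the product topology.) -/
abbrev zariskiTopology (n l : ℕ) : TopologicalSpace (MatTuple n l) :=
  TopologicalSpace.ofClosed {Z | IsAlgebraicSet Z} isAlgebraicSet_empty
    (fun _ hT => IsAlgebraicSet.sInter hT) (fun _ hY _ hZ => IsAlgebraicSet.union hY hZ)

/-- An irreducible projective variety in `(ℙ M_n(ℂ))^l`: a Zariski closed subset that is
irreducible (in particular nonempty) in the Zariski topology. -/
def IsIrreducibleProjectiveVariety {n l : ℕ} (Z : Set (MatTuple n l)) : Prop :=
  @IsClosed (MatTuple n l) (zariskiTopology n l) Z ∧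
    @IsIrreducible (MatTuple n l) (zariskiTopology n l) Z

/-- The tuples `([A_1], …, [A_l])` for which there are subspaces `V_1, …, V_l` of `ℂ^n` with `V_i`
invariant under `A_i`, `dim V_i = k_i`, and `V_1 + ⋯ + V_l ≠ ℂ^n`. The condition does not
depend on the representatives `A_i`. -/
def dependentTuples (n l : ℕ) (k : Fin l → ℕ) : Set (MatTuple n l) :=
  {p | ∃ V : Fin l → Submodule ℂ (Fin n → ℂ),
    (∀ i, ∀ v ∈ V i, (p i).rep.mulVec v ∈ V i) ∧
    (∀ i, Module.finrank ℂ (V i) = k i) ∧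
    (⨆ i, V i) ≠ ⊤}

/-! A sum of subspaces is proper exactly when it lies in the kernel of some covector φ ≠ 0, so the
set consists of the tuples for which some φ ≠ 0 has, for every i, an A_i-invariant subspace of
dimension k_i inside ker φ.

Closedness: the largest A-invariant subspace of ker φ is the common kernel of the covectors φAʲ, and
over an algebraically closed field it contains invariant subspaces of every smaller dimension. The
condition on (φ, A) is thus the vanishing of minors (`Matrix.exists_invariant_submodule_iff`) that
are homogeneous in φ and multihomogeneous in A. Since φ ranges over a projective space, it can be
eliminated (`MvPolynomial.exists_eliminant`, via the Nullstellensatz).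

Irreducibility: in bases adapted to V_i ⊆ ker φ, each A_i becomes P_i B_i P_i⁻¹ with B_i block
triangular and P_i = g h_i, where g moves a fixed hyperplane and h_i preserves it. The data (g, h,
B) form a linear space, up to nonvanishing determinants. A line joining two data gives a polynomial
path between two given points which stays in the set for all but finitely many parameters
(`exists_path_dependentTuples`). Two nonempty relatively open subsets therefore meet on such a path.
-/

/-! ### Elimination theory -/

theorem exists_submatrix_det_ne_zero {K ι Γ : Type*} [Field K] [Fintype Γ] [DecidableEq Γ]
    (v : ι → Γ → K) (hv : ⊤ ≤ Submodule.span K (Set.range v)) :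
    ∃ s : Γ → ι, (Matrix.of fun a b => v (s a) b).det ≠ 0 := by
  let b := Module.Basis.ofSpan hv
  let e := b.indexEquiv (Pi.basisFun K Γ)
  have hb : ∀ a : Γ, ∃ i, v i = b (e.symm a) := fun a =>
    Module.Basis.ofSpan_subset hv ⟨e.symm a, rfl⟩
  choose s hs using hb
  refine ⟨s, ?_⟩
  have hli : LinearIndependent K (fun a => b (e.symm a)) :=
    b.linearIndependent.comp _ e.symm.injective
  have h2 : LinearIndependent K (Matrix.of fun a b => v (s a) b).row := by
    convert hli using 1
    funext a
    exact hs a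
  exact ((Matrix.isUnit_iff_isUnit_det _).mp
    (Matrix.linearIndependent_rows_iff_isUnit.mp h2)).ne_zero

theorem Matrix.isWeightedHomogeneous_det {R σ M Γ : Type*} [CommRing R] [AddCommMonoid M]
    [Fintype Γ] [DecidableEq Γ] {w : σ → M} (A : Matrix Γ Γ (MvPolynomial σ R)) (e : Γ → M)
    (hA : ∀ a b, (A a b).IsWeightedHomogeneous w (e a)) :
    A.det.IsWeightedHomogeneous w (∑ a, e a) := by
  rw [← Matrix.det_transpose, Matrix.det_apply]
  refine MvPolynomial.IsWeightedHomogeneous.sum _ _ _ fun π _ => ?_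
  have := MvPolynomial.IsWeightedHomogeneous.prod (w := w) Finset.univ
    (fun a => A.transpose (π a) a) e (fun a _ => hA a (π a))
  rcases Int.units_eq_one_or (Equiv.Perm.sign π) with h | h
  · simpa [h] using this
  · simpa [h] using this.neg

/-- The ideal is spanned over K by products of a monomial with some `f j`; these are homogeneous, so
taking the component of degree `N` keeps or kills each one. This turns ideal membership into linear
algebra in a single degree. -/
theorem MvPolynomial.homogeneousComponent_mem_span_of_mem_span {K τ J : Type*} [Field K]
    {f : J → MvPolynomial τ K} {d : J → ℕ} (hf : ∀ j, (f j).IsHomogeneous (d j)) (N : ℕ)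
    {q : MvPolynomial τ K} (hq : q ∈ Ideal.span (Set.range f)) :
    homogeneousComponent N q ∈ Submodule.span K
      (Set.range fun s : {s : (τ →₀ ℕ) × J // s.1.degree + d s.2 = N} =>
        monomial s.1.1 (1 : K) * f s.1.2) := by
  classical
  induction hq using Submodule.span_induction with
  | zero => simp
  | add x y _ _ hx hy => rw [map_add]; exact add_mem hx hy
  | mem x hx =>
    obtain ⟨j, rfl⟩ := hx
    rw [homogeneousComponent_of_mem (hf j)]
    split_ifs with h
    · exact Submodule.subset_span ⟨⟨(0, j), by simp [h]⟩, by simp⟩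
    · exact zero_mem _
  | smul a x hx' hx =>
    clear hx
    induction hx' using Submodule.span_induction generalizing a with
    | zero => simp
    | add x y _ _ hx hy => rw [smul_add, map_add]; exact add_mem (hx a) (hy a)
    | smul b x _ hx => rw [smul_smul]; exact hx _
    | mem x hx =>
      obtain ⟨j, rfl⟩ := hx
      induction a using MvPolynomial.induction_on' with
      | add p q hp hq => rw [add_smul, map_add]; exact add_mem hp hq
      | monomial β c =>
        have hc : (monomial β c : MvPolynomial τ K) • f j = C c * (monomial β 1 * f j) := by
          rw [smul_eq_mul, ← mul_assoc, C_mul_monomial, mul_one]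
        rw [hc, homogeneousComponent_C_mul, ← smul_eq_C_mul]
        refine Submodule.smul_mem _ _ ?_
        rw [homogeneousComponent_of_mem ((isHomogeneous_monomial (1 : K) rfl).mul (hf j))]
        split_ifs with h
        · exact Submodule.subset_span ⟨⟨(β, j), h.symm⟩, rfl⟩
        · exact zero_mem _

/-- Projective Nullstellensatz: the only possible common zero is the origin, so every variable lies
in the radical, and the ideal of variables is finitely generated. -/
theorem MvPolynomial.exists_pow_idealOfVars_le_span {K τ J : Type*} [Field K] [IsAlgClosed K]
    [Finite τ] (f : J → MvPolynomial τ K) (h0 : ∀ x : τ → K, x ≠ 0 → ∃ j, eval x (f j) ≠ 0) :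
    ∃ N, idealOfVars τ K ^ N ≤ Ideal.span (Set.range f) := by
  refine Ideal.exists_pow_le_of_le_radical_of_fg ?_ (idealOfVars_fg τ K)
  rw [← vanishingIdeal_zeroLocus_eq_radical (K := K), idealOfVars, Ideal.span_le]
  rintro _ ⟨i, rfl⟩
  rw [SetLike.mem_coe, mem_vanishingIdeal_iff]
  intro x hx
  rw [mem_zeroLocus_iff] at hx
  have : x = 0 := by
    by_contra hne
    obtain ⟨j, hj⟩ := h0 x hne
    exact hj (hx (f j) (Ideal.subset_span ⟨j, rfl⟩))
  simp [this]

/-- Elimination: if a system of polynomials that are homogeneous in `x`, with weighted homogeneous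
coefficients in `y`, has no nontrivial solution `x` at `y = y₀`, then some weighted homogeneous
polynomial in `y` is nonzero at `y₀` but vanishes wherever a nontrivial solution exists. -/
theorem MvPolynomial.exists_eliminant {K σ τ J M : Type*} [Field K] [IsAlgClosed K] [Fintype τ]
    [DecidableEq τ] [AddCommMonoid M] {w : σ → M} (f : J → MvPolynomial τ (MvPolynomial σ K))
    (d : J → ℕ) (e : J → M) (hf : ∀ j, (f j).IsHomogeneous (d j))
    (hc : ∀ j γ, (coeff γ (f j)).IsWeightedHomogeneous w (e j)) (y₀ : σ → K)
    (h0 : ∀ x : τ → K, x ≠ 0 → ∃ j, eval x (map (eval y₀) (f j)) ≠ 0) :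
    ∃ F : MvPolynomial σ K, (∃ m, F.IsWeightedHomogeneous w m) ∧ eval y₀ F ≠ 0 ∧
      ∀ y, (∃ x : τ → K, x ≠ 0 ∧ ∀ j, eval x (map (eval y) (f j)) = 0) → eval y F = 0 := by
  classical
  obtain ⟨N, hN⟩ := exists_pow_idealOfVars_le_span (fun j => map (eval y₀) (f j)) h0
  -- `Γ` indexes the monomials of degree `N`; `I` below indexes the multiples of the `f j` that have
  -- degree `N`. The eliminant is a maximal minor of the matrix of coefficients (a Macaulay matrix),
  -- chosen to be nonzero at `y₀`.
  let Γ := {γ : τ →₀ ℕ // γ ∈ Finset.finsuppAntidiag (Finset.univ : Finset τ) N}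
  have hΓ : ∀ γ : τ →₀ ℕ, γ ∈ Finset.finsuppAntidiag (Finset.univ : Finset τ) N ↔
      γ.degree = N := by
    intro γ
    simp [Finset.mem_finsuppAntidiag, Finsupp.degree_eq_sum]
  let I := {s : (τ →₀ ℕ) × J // s.1.degree + d s.2 = N}
  let g : I → MvPolynomial τ (MvPolynomial σ K) := fun s => monomial s.1.1 1 * f s.1.2
  have hg : ∀ s, (g s).IsHomogeneous N := fun s => by
    have := (isHomogeneous_monomial (1 : MvPolynomial σ K) (rfl : s.1.1.degree = _)).mul
      (hf s.1.2)
    rwa [s.2] at this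
  have hgc : ∀ s γ, (coeff γ (g s)).IsWeightedHomogeneous w (e s.1.2) := fun s γ => by
    simp only [g, coeff_monomial_mul', one_mul]
    split_ifs
    · exact hc _ _
    · exact isWeightedHomogeneous_zero _ _ _
  let L : MvPolynomial τ K →ₗ[K] (Γ → K) := LinearMap.pi fun γ => lcoeff K γ.1
  have hL : ⊤ ≤ Submodule.span K
      (Set.range fun (s : I) (γ : Γ) => coeff γ.1 (map (eval y₀) (g s))) := by
    have h1 : (Set.range fun (s : I) (γ : Γ) => coeff γ.1 (map (eval y₀) (g s))) =
        L '' Set.range fun s : I => monomial s.1.1 (1 : K) * map (eval y₀) (f s.1.2) := by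
      rw [← Set.range_comp]
      congr 1
      funext s γ
      simp [L, g]
    rw [h1, Submodule.span_image, ← (Pi.basisFun K Γ).span_eq, Submodule.span_le]
    rintro _ ⟨γ, rfl⟩
    refine ⟨monomial γ.1 1, ?_, ?_⟩
    · have h2 := homogeneousComponent_mem_span_of_mem_span (fun j => (hf j).map (eval y₀)) N
        (hN ((monomial_mem_pow_idealOfVars_iff N γ.1 one_ne_zero).mpr ((hΓ _).mp γ.2).ge))
      rwa [homogeneousComponent_of_mem (isHomogeneous_monomial (1 : K) ((hΓ _).mp γ.2)),
        if_pos rfl] at h2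
    · funext δ
      rw [Pi.basisFun_apply, Pi.single_apply]
      simp only [L, LinearMap.pi_apply, lcoeff_apply, coeff_monomial]
      exact if_congr (by rw [Subtype.ext_iff, eq_comm]) rfl rfl
  obtain ⟨s, hs⟩ := exists_submatrix_det_ne_zero _ hL
  let A : Matrix Γ Γ (MvPolynomial σ K) := Matrix.of fun a b => coeff b.1 (g (s a))
  have hA : ∀ y, eval y A.det = (Matrix.of fun a b : Γ =>
      coeff b.1 (map (eval y) (g (s a)))).det := fun y => by
    simp only [RingHom.map_det, coeff_map]
    rfl
  refine ⟨A.det, ⟨_, A.isWeightedHomogeneous_det _ fun a b => hgc (s a) b.1⟩, ?_, ?_⟩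
  · rw [hA]; exact hs
  · rintro y ⟨x, hx, hxj⟩
    rw [hA]
    -- A common zero `x` puts the vector of all its degree `N` monomials in the kernel; it is
    -- nonzero because it contains a power of a nonzero coordinate.
    refine Matrix.exists_mulVec_eq_zero_iff.mp ⟨fun γ => ∏ i, x i ^ γ.1 i, ?_, ?_⟩
    · obtain ⟨i, hi⟩ := Function.ne_iff.mp hx
      intro h
      have := congrFun h ⟨Finsupp.single i N, (hΓ _).mpr (by simp)⟩
      simp only [Pi.zero_apply, Finset.prod_eq_zero_iff, Finsupp.single_apply] at this
      obtain ⟨j, -, hj⟩ := this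
      split_ifs at hj with hij
      · subst hij; exact hi (eq_zero_of_pow_eq_zero hj)
      · simp at hj
    · funext a
      have h1 : eval x (map (eval y) (g (s a))) = 0 := by
        simp [g, hxj]
      rw [eval_eq'] at h1
      have h2 : ∀ γ ∈ (map (eval y) (g (s a))).support, γ.degree = N := fun γ hγ => by
        by_contra hne
        exact (mem_support_iff.mp hγ) (((hg (s a)).map (eval y)).coeff_eq_zero hne)
      rw [Finset.sum_subset (s₂ := Finset.finsuppAntidiag (Finset.univ : Finset τ) N)
        (fun γ hγ => (hΓ γ).mpr (h2 γ hγ))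
        (fun γ _ hγ => by rw [notMem_support_iff.mp hγ, zero_mul])] at h1
      rw [Pi.zero_apply, ← h1]
      exact (Finset.sum_coe_sort (Finset.finsuppAntidiag (Finset.univ : Finset τ) N)
        fun γ => coeff γ (map (eval y) (g (s a))) * ∏ i, x i ^ γ i)

/-! ### Invariant subspaces inside a hyperplane -/

section

open scoped Matrix

/-- For an eigenvalue c, the range of f − c on W is proper. Any hyperplane of W containing it is
invariant, so the dimension can be lowered by one at a time. -/
theorem Module.End.exists_invariant_submodule_le {K E : Type*} [Field K] [IsAlgClosed K]
    [AddCommGroup E] [Module K E] [FiniteDimensional K E] (f : Module.End K E) (k d : ℕ)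
    (W : Submodule K E) (hW : ∀ v ∈ W, f v ∈ W) (hd : Module.finrank K W = k + d) :
    ∃ V ≤ W, (∀ v ∈ V, f v ∈ V) ∧ Module.finrank K V = k := by
  induction d generalizing W with
  | zero => exact ⟨W, le_rfl, hW, hd⟩
  | succ d ih =>
    have hnt : Nontrivial W := Module.finrank_pos_iff (R := K).mp (by omega)
    let g : Module.End K W := f.restrict hW
    obtain ⟨c, hc⟩ := Module.End.exists_eigenvalue g
    have hlt : (g - algebraMap K _ c).range < ⊤ := by
      rw [lt_top_iff_ne_top]
      intro h
      have hinj := LinearMap.ker_eq_bot_iff_range_eq_top.mpr h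
      exact hc (by rw [Module.End.genEigenspace_one]; exact hinj)
    obtain ⟨ψ, hψ, hle⟩ := Submodule.exists_le_ker_of_lt_top _ hlt
    have hfr := Module.Dual.finrank_ker_add_one_of_ne_zero hψ
    obtain ⟨V, hV, hVi, hVk⟩ := ih ((LinearMap.ker ψ).map W.subtype) (by
      rintro _ ⟨v, hv, rfl⟩
      refine ⟨g v, ?_, rfl⟩
      have h1 : (g - algebraMap K _ c) v ∈ LinearMap.ker ψ := hle ⟨v, rfl⟩
      have h2 : g v = (g - algebraMap K _ c) v + c • v := by simp
      rw [h2]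
      exact add_mem h1 (Submodule.smul_mem _ _ hv)) (by
      rw [Submodule.finrank_map_subtype_eq]; omega)
    exact ⟨V, hV.trans (Submodule.map_subtype_le _ _), hVi, hVk⟩

theorem LinearIndependent.exists_submatrix_det_ne_zero {K τ : Type*} [Field K] [Fintype τ]
    {m : ℕ} {u : Fin m → τ → K} (hu : LinearIndependent K u) :
    ∃ c : Fin m → τ, (Matrix.of fun a b => u a (c b)).det ≠ 0 := by
  obtain ⟨c, hc⟩ := _root_.exists_submatrix_det_ne_zero (fun t a => u a t) (by
    refine (Submodule.eq_top_of_finrank_eq ?_).ge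
    have h1 := Matrix.range_mulVecLin (Matrix.of u)
    have h2 : (Matrix.of u).rank = Fintype.card (Fin m) :=
      LinearIndependent.rank_matrix (M := Matrix.of u) hu
    rw [Matrix.rank, h1] at h2
    rw [Module.finrank_fintype_fun_eq_card]
    exact h2)
  refine ⟨c, ?_⟩
  rw [← Matrix.det_transpose]
  exact hc

/-- A matrix `A` has an invariant subspace of dimension `k` inside the kernel of a covector `φ` if
and only if the minors of size `n - k + 1` of the family `φ Aʲ` vanish. -/
theorem Matrix.exists_invariant_submodule_iff {K τ : Type*} [Field K] [IsAlgClosed K] [Fintype τ]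
    [DecidableEq τ] (A : Matrix τ τ K) (φ : τ → K) {k m : ℕ} (hm : m + k = Fintype.card τ + 1) :
    (∃ V : Submodule K (τ → K), (∀ v ∈ V, A *ᵥ v ∈ V) ∧ Module.finrank K V = k ∧
      ∀ v ∈ V, φ ⬝ᵥ v = 0) ↔
    ∀ (r : Fin m → ℕ) (c : Fin m → τ),
      (Matrix.of fun a b => (φ ᵥ* A ^ r a) (c b)).det = 0 := by
  constructor
  · rintro ⟨V, hV, hk, hφ⟩ r c
    by_contra hdet
    let M : Matrix (Fin m) τ K := Matrix.of fun a => φ ᵥ* A ^ r a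
    have hli : LinearIndependent K M.row := by
      rw [Fintype.linearIndependent_iff]
      intro g hg
      refine congrFun (Matrix.eq_zero_of_vecMul_eq_zero hdet (v := g) ?_)
      funext b
      have := congrFun hg (c b)
      simpa [Matrix.vecMul, dotProduct, M, Finset.sum_apply, Matrix.row] using this
    have hr := hli.rank_matrix
    -- A nonzero minor would give M rank m, hence a kernel of dimension k − 1, too small to contain
    -- V.
    have hker : V ≤ LinearMap.ker M.mulVecLin := by
      intro v hv
      have hpow : ∀ j, A ^ j *ᵥ v ∈ V := by
        intro j
        induction j with
        | zero => simpa using hv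
        | succ j ih => rw [pow_succ', ← Matrix.mulVec_mulVec]; exact hV _ ih
      rw [LinearMap.mem_ker]
      funext a
      change (φ ᵥ* A ^ r a) ⬝ᵥ v = 0
      rw [← Matrix.dotProduct_mulVec]
      exact hφ _ (hpow _)
    have h1 := Submodule.finrank_mono hker
    have h2 := M.mulVecLin.finrank_range_add_finrank_ker
    rw [Matrix.rank] at hr
    simp only [Module.finrank_fintype_fun_eq_card, Fintype.card_fin] at h2 hr
    omega
  · intro h
    let u : ℕ → τ → K := fun j => φ ᵥ* A ^ j
    -- A basis of the span of all φAʲ has fewer than m elements, so its common kernel has dimension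
    -- at least k. This kernel is killed by every φAʲ, hence is invariant.
    obtain ⟨b, hbs, hspan, hli⟩ := exists_linearIndependent K (Set.range u)
    have : Fintype b := hli.setFinite.fintype
    let e := Fintype.equivFin b
    have hr : ∀ a : Fin (Fintype.card b), ∃ j, u j = (e.symm a : τ → K) :=
      fun a => hbs (e.symm a).2
    choose r hr using hr
    have hli' : LinearIndependent K fun a => u (r a) := by
      have : (fun a => u (r a)) = fun a => ((e.symm a : b) : τ → K) := funext hr
      rw [this]
      exact hli.comp _ e.symm.injective
    have hlt : Fintype.card b < m := by
      by_contra hge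
      obtain ⟨c, hc⟩ := (hli'.comp (Fin.castLE (not_lt.mp hge))
        (Fin.castLE_injective _)).exists_submatrix_det_ne_zero
      exact hc (h _ c)
    let M : Matrix (Fin (Fintype.card b)) τ K := Matrix.of fun a => u (r a)
    have hMr : M.rank = _ := LinearIndependent.rank_matrix (M := M) hli'
    have h2 := M.mulVecLin.finrank_range_add_finrank_ker
    rw [Matrix.rank] at hMr
    simp only [Module.finrank_fintype_fun_eq_card, Fintype.card_fin] at h2 hMr
    have hker : ∀ v ∈ LinearMap.ker M.mulVecLin, ∀ j, u j ⬝ᵥ v = 0 := by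
      intro v hv j
      have key : Submodule.span K b ≤ LinearMap.ker ((dotProductBilin K K).flip v) := by
        rw [Submodule.span_le]
        intro x hx
        have h3 := congrFun (LinearMap.mem_ker.mp hv) (e ⟨x, hx⟩)
        have h4 : u (r (e ⟨x, hx⟩)) = x := by rw [hr]; simp
        rw [SetLike.mem_coe, LinearMap.mem_ker, ← h4]
        exact h3
      exact key (hspan ▸ Submodule.subset_span ⟨j, rfl⟩)
    obtain ⟨V, hV, hVi, hVk⟩ := Module.End.exists_invariant_submodule_le A.mulVecLin k
      (Module.finrank K (LinearMap.ker M.mulVecLin) - k) (LinearMap.ker M.mulVecLin) (by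
        intro v hv
        rw [LinearMap.mem_ker]
        funext a
        change u (r a) ⬝ᵥ (A *ᵥ v) = 0
        rw [Matrix.dotProduct_mulVec]
        have := hker v hv (r a + 1)
        simpa [u, pow_succ, Matrix.vecMul_vecMul] using this) (by omega)
    refine ⟨V, hVi, hVk, fun v hv => ?_⟩
    simpa [u] using hker v (hV hv) 0

end

/-! ### Generic minors and closedness -/

section

open scoped Matrix

/-- In the Leibniz expansion every term uses each row once, and the weight depends only on the row.
-/
theorem MvPolynomial.coeff_det_isWeightedHomogeneous {R σ τ M Γ : Type*} [CommRing R]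
    [AddCommMonoid M] [Fintype Γ] [DecidableEq Γ] {w : σ → M}
    (A : Matrix Γ Γ (MvPolynomial τ (MvPolynomial σ R))) (e : Γ → M)
    (hA : ∀ a b γ, (coeff γ (A a b)).IsWeightedHomogeneous w (e a)) (γ : τ →₀ ℕ) :
    (coeff γ A.det).IsWeightedHomogeneous w (∑ a, e a) := by
  classical
  have hprod : ∀ (π : Equiv.Perm Γ) (s : Finset Γ) (γ : τ →₀ ℕ),
      (coeff γ (∏ a ∈ s, A a (π a))).IsWeightedHomogeneous w (∑ a ∈ s, e a) := by
    intro π s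
    induction s using Finset.induction_on with
    | empty =>
      intro γ
      rw [Finset.prod_empty, coeff_one]
      split_ifs
      · exact isWeightedHomogeneous_one _ _
      · exact isWeightedHomogeneous_zero _ _ _
    | insert a s ha ih =>
      intro γ
      rw [Finset.prod_insert ha, Finset.sum_insert ha, coeff_mul]
      exact IsWeightedHomogeneous.sum _ _ _ fun x _ => (hA a (π a) x.1).mul (ih x.2)
  rw [← Matrix.det_transpose, Matrix.det_apply, coeff_sum]
  refine IsWeightedHomogeneous.sum _ _ _ fun π _ => ?_
  have := hprod π Finset.univ γ
  rcases Int.units_eq_one_or (Equiv.Perm.sign π) with h | h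
  · simpa [h] using this
  · simpa [h] using this.neg

/-- The `i`-th matrix of indeterminates. -/
noncomputable def entryMatrix (n l : ℕ) (i : Fin l) : Matrix (Fin n) (Fin n) (EntryPoly n l) :=
  Matrix.of fun a b => MvPolynomial.X (i, a, b)

theorem isWeightedHomogeneous_entryMatrix_pow {n l : ℕ} (i : Fin l) (j : ℕ) (a b : Fin n) :
    ((entryMatrix n l i ^ j) a b).IsWeightedHomogeneous
      (fun x : Fin l × Fin n × Fin n => (Pi.single x.1 1 : Fin l → ℕ))
      (j • Pi.single i 1) := by
  induction j generalizing a b with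
  | zero =>
    rw [pow_zero, zero_smul, Matrix.one_apply]
    split_ifs
    · exact MvPolynomial.isWeightedHomogeneous_one _ _
    · exact MvPolynomial.isWeightedHomogeneous_zero _ _ _
  | succ j ih =>
    rw [pow_succ, succ_nsmul, Matrix.mul_apply]
    exact MvPolynomial.IsWeightedHomogeneous.sum _ _ _ fun t _ =>
      (ih a t).mul (MvPolynomial.isWeightedHomogeneous_X ℂ _ (i, t, b))

/-- Minors of the family `φ A_iʲ`, with `φ` and `A_i` generic. -/
noncomputable def krylovMinor (n l : ℕ) (i : Fin l) {m : ℕ} (r : Fin m → ℕ) (c : Fin m → Fin n) :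
    MvPolynomial (Fin n) (EntryPoly n l) :=
  (Matrix.of fun a b =>
    (MvPolynomial.X ᵥ* (entryMatrix n l i ^ r a).map MvPolynomial.C) (c b)).det

theorem isHomogeneous_krylovMinor {n l : ℕ} (i : Fin l) {m : ℕ} (r : Fin m → ℕ)
    (c : Fin m → Fin n) : (krylovMinor n l i r c).IsHomogeneous m := by
  have hentry : ∀ a b, ((Matrix.of fun a b => (MvPolynomial.X ᵥ* (entryMatrix n l i ^ r a).map
      MvPolynomial.C) (c b) : Matrix (Fin m) (Fin m) (MvPolynomial (Fin n) (EntryPoly n l)))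
        a b).IsHomogeneous 1 := by
    intro a b
    rw [Matrix.of_apply, Matrix.vecMul, dotProduct]
    exact MvPolynomial.IsHomogeneous.sum _ _ _ fun t _ =>
      (MvPolynomial.isHomogeneous_X _ t).mul (MvPolynomial.isHomogeneous_C _ _)
  have := Matrix.isWeightedHomogeneous_det _ (fun _ => 1) hentry
  rwa [Finset.sum_const, Finset.card_univ, Fintype.card_fin, smul_eq_mul, mul_one] at this

theorem coeff_krylovMinor_isWeightedHomogeneous {n l : ℕ} (i : Fin l) {m : ℕ} (r : Fin m → ℕ)
    (c : Fin m → Fin n) (γ : Fin n →₀ ℕ) :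
    ((krylovMinor n l i r c).coeff γ).IsWeightedHomogeneous
      (fun x : Fin l × Fin n × Fin n => (Pi.single x.1 1 : Fin l → ℕ))
      (∑ a, r a • Pi.single i 1) := by
  refine MvPolynomial.coeff_det_isWeightedHomogeneous _ _ (fun a b γ => ?_) γ
  rw [Matrix.of_apply, Matrix.vecMul, dotProduct, MvPolynomial.coeff_sum]
  refine MvPolynomial.IsWeightedHomogeneous.sum _ _ _ fun t _ => ?_
  rw [Matrix.map_apply, mul_comm, MvPolynomial.coeff_C_mul, MvPolynomial.coeff_X]
  split_ifs
  · rw [mul_one]; exact isWeightedHomogeneous_entryMatrix_pow _ _ _ _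
  · rw [mul_zero]; exact MvPolynomial.isWeightedHomogeneous_zero _ _ _

theorem eval_krylovMinor {n l : ℕ} (i : Fin l) {m : ℕ} (r : Fin m → ℕ) (c : Fin m → Fin n)
    (A : Fin l → Matrix (Fin n) (Fin n) ℂ) (φ : Fin n → ℂ) :
    MvPolynomial.eval φ (MvPolynomial.map (MvPolynomial.eval
      fun x : Fin l × Fin n × Fin n => A x.1 x.2.1 x.2.2) (krylovMinor n l i r c)) =
    (Matrix.of fun a b => (φ ᵥ* A i ^ r a) (c b)).det := by
  set E := MvPolynomial.eval fun x : Fin l × Fin n × Fin n => A x.1 x.2.1 x.2.2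
  have hE : ∀ j, E.mapMatrix (entryMatrix n l i ^ j) = A i ^ j := by
    intro j
    rw [map_pow]
    congr 1
    ext a b
    simp [E, entryMatrix]
  rw [krylovMinor, RingHom.map_det, RingHom.map_det]
  congr 1
  ext a b
  simp [Matrix.vecMul, dotProduct, ← hE]

theorem mem_dependentTuples_iff {n l : ℕ} {k : Fin l → ℕ} {p : MatTuple n l}
    {A : Fin l → Matrix (Fin n) (Fin n) ℂ}
    (hA : ∀ i, ∃ h : A i ≠ 0, Projectivization.mk ℂ (A i) h = p i) :
    p ∈ dependentTuples n l k ↔ ∃ φ : Fin n → ℂ, φ ≠ 0 ∧ ∀ i,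
      ∃ V : Submodule ℂ (Fin n → ℂ), (∀ v ∈ V, A i *ᵥ v ∈ V) ∧ Module.finrank ℂ V = k i ∧
        ∀ v ∈ V, φ ⬝ᵥ v = 0 := by
  have hinv : ∀ i (V : Submodule ℂ (Fin n → ℂ)),
      (∀ v ∈ V, (p i).rep *ᵥ v ∈ V) ↔ ∀ v ∈ V, A i *ᵥ v ∈ V := by
    intro i V
    obtain ⟨h0, h1⟩ := hA i
    rw [← (p i).mk_rep, Projectivization.mk_eq_mk_iff] at h1
    obtain ⟨c, hc⟩ := h1
    refine forall₂_congr fun v _ => ?_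
    rw [← hc, Units.smul_def, Matrix.smul_mulVec]
    exact (V.smul_mem_iff c.ne_zero).symm
  constructor
  · rintro ⟨V, hV, hk, htop⟩
    obtain ⟨f, hf, hle⟩ := Submodule.exists_le_ker_of_lt_top _ (lt_top_iff_ne_top.mpr htop)
    have hdot : ∀ v, (fun a => f (Pi.single a 1)) ⬝ᵥ v = f v := by
      intro v
      conv_rhs => rw [pi_eq_sum_univ' v, map_sum]
      simp [dotProduct, mul_comm]
    refine ⟨fun a => f (Pi.single a 1), ?_, fun i => ⟨V i, (hinv i _).mp (hV i), hk i, ?_⟩⟩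
    · intro h
      refine hf (LinearMap.ext fun v => ?_)
      rw [← hdot, h, zero_dotProduct, LinearMap.zero_apply]
    · intro v hv
      rw [hdot]
      exact hle (le_iSup V i hv)
  · rintro ⟨φ, hφ, h⟩
    choose V hV hk hdot using h
    refine ⟨V, fun i => (hinv i _).mpr (hV i), hk, fun htop => hφ ?_⟩
    have hle : (⨆ i, V i) ≤ LinearMap.ker (dotProductBilin ℂ ℂ φ) :=
      iSup_le fun i v hv => hdot i v hv
    refine dotProduct_eq_zero φ fun v => ?_
    exact hle (htop ▸ Submodule.mem_top)

theorem isAlgebraicSet_dependentTuples {n l : ℕ} {k : Fin l → ℕ} (hk : ∀ i, k i ≤ n) :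
    IsAlgebraicSet (dependentTuples n l k) := by
  -- The equations are all multihomogeneous polynomials vanishing on the set; it remains to separate
  -- each outside point by an eliminant.
  refine ⟨{F | IsMultihomogeneous F ∧ ∀ q ∈ dependentTuples n l k, VanishesAt F q},
    fun F hF => hF.1, Set.Subset.antisymm (fun q hq F hF => hF.2 q hq) fun p hp => ?_⟩
  by_contra hpn
  have hrep : ∀ (q : MatTuple n l) (i : Fin l),
      ∃ h : (q i).rep ≠ 0, Projectivization.mk ℂ (q i).rep h = q i :=
    fun q i => ⟨(q i).rep_nonzero, (q i).mk_rep⟩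
  have hminor : ∀ (q : MatTuple n l) (φ : Fin n → ℂ) (i : Fin l),
      (∃ V : Submodule ℂ (Fin n → ℂ), (∀ v ∈ V, (q i).rep *ᵥ v ∈ V) ∧
        Module.finrank ℂ V = k i ∧ ∀ v ∈ V, φ ⬝ᵥ v = 0) ↔ _ := fun q φ i =>
    Matrix.exists_invariant_submodule_iff (q i).rep φ (k := k i) (m := n + 1 - k i)
      (by have := hk i; simp only [Fintype.card_fin]; omega)
  obtain ⟨F, hF, hF0, hFv⟩ := MvPolynomial.exists_eliminant
    (J := Σ i : Fin l, (Fin (n + 1 - k i) → ℕ) × (Fin (n + 1 - k i) → Fin n))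
    (w := fun x : Fin l × Fin n × Fin n => (Pi.single x.1 1 : Fin l → ℕ))
    (fun j => krylovMinor n l j.1 j.2.1 j.2.2) _ _
    (fun j => isHomogeneous_krylovMinor _ _ _)
    (fun j => coeff_krylovMinor_isWeightedHomogeneous _ _ _)
    (fun x => (p x.1).rep x.2.1 x.2.2) (by
      intro φ hφ
      by_contra! hall
      refine hpn ((mem_dependentTuples_iff (hrep p)).mpr ⟨φ, hφ, fun i => ?_⟩)
      refine (hminor p φ i).mpr fun r c => ?_
      have := hall ⟨i, r, c⟩
      rwa [eval_krylovMinor _ _ _ (fun i => (p i).rep)] at this)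
  refine hF0 ((IsMultihomogeneous.vanishesAt_iff hF p).mp (hp F ⟨hF, fun q hq => ?_⟩))
  rw [IsMultihomogeneous.vanishesAt_iff hF]
  obtain ⟨φ, hφ, hV⟩ := (mem_dependentTuples_iff (hrep q)).mp hq
  refine hFv _ ⟨φ, hφ, fun j => ?_⟩
  rw [eval_krylovMinor _ _ _ (fun i => (q i).rep)]
  exact (hminor q φ j.1).mp (hV j.1) _ _

end

/-! ### Adapted bases and the parametrization -/

section

open scoped Matrix

/-- Greedy choice: `S a` is too large to lie in the span of the a vectors already chosen. -/
theorem exists_linearIndependent_mem {K E : Type*} [Field K] [AddCommGroup E] [Module K E]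
    [FiniteDimensional K E] (S : ℕ → Submodule K E) (N : ℕ)
    (hS : ∀ a < N, a < Module.finrank K (S a)) :
    ∃ v : Fin N → E, LinearIndependent K v ∧ ∀ a : Fin N, v a ∈ S a := by
  induction N with
  | zero => exact ⟨Fin.elim0, linearIndependent_empty_type, fun a => a.elim0⟩
  | succ N ih =>
    obtain ⟨v, hv, hvS⟩ := ih fun a ha => hS a (by omega)
    have hnot : ¬ S N ≤ Submodule.span K (Set.range v) := by
      intro hle
      have h1 := Submodule.finrank_mono hle
      have h2 := finrank_span_eq_card hv
      have h3 := hS N (by omega)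
      rw [Fintype.card_fin] at h2
      omega
    obtain ⟨x, hx, hxv⟩ := SetLike.not_le_iff_exists.mp hnot
    refine ⟨Fin.snoc v x, linearIndependent_finSnoc.mpr ⟨hv, hxv⟩, fun a => ?_⟩
    induction a using Fin.lastCases with
    | last => simpa using hx
    | cast a => simpa using hvS a

theorem Matrix.linearIndependent_col_of_det_ne_zero {K τ : Type*} [Field K] [Fintype τ]
    [DecidableEq τ] {P : Matrix τ τ K} (hP : P.det ≠ 0) : LinearIndependent K P.col :=
  Matrix.linearIndependent_cols_iff_isUnit.mpr
    ((Matrix.isUnit_iff_isUnit_det _).mpr hP.isUnit)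

/-- An invariant subspace inside a hyperplane yields a change of basis making the matrix block
triangular, the basis being adapted to both subspaces. -/
theorem exists_blockTriangular_of_invariant {K : Type*} [Field K] {n k : ℕ} (hk : k < n)
    {A : Matrix (Fin n) (Fin n) K} {φ : Fin n → K} {V : Submodule K (Fin n → K)}
    (hV : ∀ v ∈ V, A *ᵥ v ∈ V) (hVk : Module.finrank K V = k) (hφ : ∀ v ∈ V, φ ⬝ᵥ v = 0) :
    ∃ P B : Matrix (Fin n) (Fin n) K, P.det ≠ 0 ∧ (∀ a : Fin n, a.1 + 1 < n → (φ ᵥ* P) a = 0) ∧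
      (∀ a b : Fin n, b.1 < k → k ≤ a.1 → B a b = 0) ∧ A * P = P * B := by
  classical
  let H : Submodule K (Fin n → K) := LinearMap.ker (dotProductBilin K K φ)
  have hH : n ≤ Module.finrank K H + 1 := by
    have h1 := (dotProductBilin K K φ).finrank_range_add_finrank_ker
    have h2 := (LinearMap.range (dotProductBilin K K φ)).finrank_le
    rw [Module.finrank_self] at h2
    rw [Module.finrank_fintype_fun_eq_card, Fintype.card_fin] at h1
    change _ + Module.finrank K H = _ at h1
    omega
  -- The first k vectors come from V, the next ones up to index n − 2 from ker φ, and the last one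
  -- is free.
  obtain ⟨v, hv, hvS⟩ := exists_linearIndependent_mem
    (fun a => if a < k then V else if a + 1 < n then H else ⊤) n (fun a ha => by
      by_cases h1 : a < k
      · rw [if_pos h1]; omega
      by_cases h2 : a + 1 < n
      · rw [if_neg h1, if_pos h2]; omega
      · rw [if_neg h1, if_neg h2, finrank_top, Module.finrank_fintype_fun_eq_card, Fintype.card_fin]; exact ha)
  let P : Matrix (Fin n) (Fin n) K := (Matrix.of v)ᵀ
  have hP : P.det ≠ 0 := by
    rw [Matrix.det_transpose]
    exact ((Matrix.isUnit_iff_isUnit_det _).mp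
      (Matrix.linearIndependent_rows_iff_isUnit.mp (show LinearIndependent K (Matrix.of v).row
        from hv))).ne_zero
  have hPu : IsUnit P.det := hP.isUnit
  have hcol : ∀ b : Fin n, b.1 < k → v b ∈ V := fun b hb => by
    have := hvS b
    rwa [if_pos hb] at this
  have hspan : Submodule.span K (Set.range fun b : Fin k => v (Fin.castLE hk.le b)) = V := by
    refine Submodule.eq_of_le_of_finrank_eq ?_ ?_
    · rw [Submodule.span_le]
      rintro _ ⟨b, rfl⟩
      exact hcol _ b.2
    · rw [hVk]
      exact (finrank_span_eq_card (hv.comp _ (Fin.castLE_injective hk.le))).trans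
        (Fintype.card_fin k)
  have hinv : ∀ a : Fin n, k ≤ a.1 → V ≤ LinearMap.ker (LinearMap.proj a ∘ₗ P⁻¹.mulVecLin) := by
    intro a ha
    rw [← hspan, Submodule.span_le]
    rintro _ ⟨b, rfl⟩
    have h1 : v (Fin.castLE hk.le b) = P *ᵥ Pi.single (Fin.castLE hk.le b) 1 := by
      rw [Matrix.mulVec_single_one]; rfl
    have h2 : a ≠ Fin.castLE hk.le b := by
      rintro rfl
      exact absurd b.2 (not_lt.mpr ha)
    simp only [SetLike.mem_coe, LinearMap.mem_ker, LinearMap.comp_apply, Matrix.mulVecLin_apply,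
      LinearMap.proj_apply]
    rw [h1, Matrix.mulVec_mulVec, Matrix.nonsing_inv_mul _ hPu, Matrix.one_mulVec,
      Pi.single_eq_of_ne h2]
  refine ⟨P, P⁻¹ * (A * P), hP, fun a ha => ?_, fun a b hb ha => ?_, ?_⟩
  · change φ ⬝ᵥ v a = 0
    have := hvS a
    by_cases hak : a.1 < k
    · exact hφ _ (hcol a hak)
    · rw [if_neg hak, if_pos ha] at this
      exact this
  · exact hinv a ha (hV _ (hcol b hb))
  · rw [← mul_assoc, Matrix.mul_nonsing_inv _ hPu, one_mul]

/-- V is spanned by the first k columns of P. The adjugate replaces the inverse, at the cost of a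
scalar, so that the matrix is polynomial in P and B. -/
theorem exists_invariant_of_blockTriangular {K : Type*} [Field K] {n k : ℕ} (hk : k < n)
    {P B : Matrix (Fin n) (Fin n) K} {φ : Fin n → K} (hP : P.det ≠ 0)
    (hφ : ∀ a : Fin n, a.1 + 1 < n → (φ ᵥ* P) a = 0)
    (hB : ∀ a b : Fin n, b.1 < k → k ≤ a.1 → B a b = 0) :
    ∃ V : Submodule K (Fin n → K), (∀ v ∈ V, (P * B * P.adjugate) *ᵥ v ∈ V) ∧
      Module.finrank K V = k ∧ ∀ v ∈ V, φ ⬝ᵥ v = 0 := by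
  let V := Submodule.span K (Set.range fun b : Fin k => P.col (Fin.castLE hk.le b))
  refine ⟨V, ?_, ?_, ?_⟩
  · suffices V ≤ V.comap (P * B * P.adjugate).mulVecLin from this
    refine Submodule.span_le.mpr ?_
    rintro _ ⟨b, rfl⟩
    have h1 : (P * B * P.adjugate) *ᵥ P.col (Fin.castLE hk.le b) =
        P.det • ∑ a, B a (Fin.castLE hk.le b) • P.col a := by
      rw [← Matrix.mulVec_single_one P, Matrix.mulVec_mulVec, mul_assoc, Matrix.adjugate_mul,
        Matrix.mul_smul, mul_one, Matrix.smul_mulVec, Matrix.mulVec_single_one]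
      congr 1
      funext i
      simp [Matrix.mul_apply, mul_comm]
    rw [SetLike.mem_coe, Submodule.mem_comap, Matrix.mulVecLin_apply, h1]
    refine V.smul_mem _ (V.sum_mem fun a _ => ?_)
    by_cases ha : a.1 < k
    · exact V.smul_mem _ (Submodule.subset_span ⟨⟨a, ha⟩, rfl⟩)
    · rw [hB _ _ b.2 (not_lt.mp ha), zero_smul]
      exact V.zero_mem
  · exact (finrank_span_eq_card ((Matrix.linearIndependent_col_of_det_ne_zero hP).comp _
      (Fin.castLE_injective hk.le))).trans (Fintype.card_fin k)
  · suffices V ≤ LinearMap.ker (dotProductBilin K K φ) from this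
    refine Submodule.span_le.mpr ?_
    rintro _ ⟨b, rfl⟩
    exact hφ _ (by have := b.2; simp only [Fin.val_castLE]; omega)

/-- The parametrization of `dependentTuples`: `g` moves a fixed hyperplane, `h i` moves a fixed
flag inside it, and `B i` is block triangular. -/
structure IsFlagDatum {K : Type*} [Field K] {n l : ℕ} (k : Fin l → ℕ)
    (g : Matrix (Fin n) (Fin n) K) (h B : Fin l → Matrix (Fin n) (Fin n) K) : Prop where
  row_eq_zero : ∀ i, ∀ a b : Fin n, n ≤ a.1 + 1 → b.1 + 1 < n → h i a b = 0
  block_eq_zero : ∀ i, ∀ a b : Fin n, b.1 < k i → k i ≤ a.1 → B i a b = 0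

theorem IsFlagDatum.exists_invariant {K : Type*} [Field K] {n l : ℕ} {k : Fin l → ℕ}
    (hk : ∀ i, k i < n) (hn : 0 < n) {g : Matrix (Fin n) (Fin n) K}
    {h B : Fin l → Matrix (Fin n) (Fin n) K} (hd : IsFlagDatum k g h B) (hg : g.det ≠ 0)
    (hh : ∀ i, (h i).det ≠ 0) :
    ∃ φ : Fin n → K, φ ≠ 0 ∧ ∀ i, ∃ V : Submodule K (Fin n → K),
      (∀ v ∈ V, (g * h i * B i * (g * h i).adjugate) *ᵥ v ∈ V) ∧ Module.finrank K V = k i ∧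
        ∀ v ∈ V, φ ⬝ᵥ v = 0 := by
  let z : Fin n := ⟨n - 1, by omega⟩
  -- Up to the factor det g, this is the last coordinate covector transported by g.
  let φ : Fin n → K := Pi.single z 1 ᵥ* g.adjugate
  have hφg : φ ᵥ* g = g.det • Pi.single z 1 := by
    rw [Matrix.vecMul_vecMul, Matrix.adjugate_mul, Matrix.vecMul_smul, Matrix.vecMul_one]
  refine ⟨φ, fun h0 => hg ?_, fun i => exists_invariant_of_blockTriangular (hk i) ?_ ?_
    (hd.block_eq_zero i)⟩
  · rw [h0, Matrix.zero_vecMul] at hφg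
    simpa using (congrFun hφg z).symm
  · rw [Matrix.det_mul]
    exact mul_ne_zero hg (hh i)
  · intro a ha
    rw [← Matrix.vecMul_vecMul, hφg, Matrix.smul_vecMul, Matrix.single_one_vecMul]
    simp only [Pi.smul_apply, Matrix.row]
    rw [hd.row_eq_zero i z a (by simp only [z]; omega) ha, smul_zero]

theorem exists_isFlagDatum {K : Type*} [Field K] {n l : ℕ} {k : Fin l → ℕ} (hl : 0 < l)
    (hk : ∀ i, k i < n) {A : Fin l → Matrix (Fin n) (Fin n) K} {φ : Fin n → K} (hφ : φ ≠ 0)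
    (hV : ∀ i, ∃ V : Submodule K (Fin n → K), (∀ v ∈ V, A i *ᵥ v ∈ V) ∧
      Module.finrank K V = k i ∧ ∀ v ∈ V, φ ⬝ᵥ v = 0) :
    ∃ (g : Matrix (Fin n) (Fin n) K) (h B : Fin l → Matrix (Fin n) (Fin n) K),
      IsFlagDatum k g h B ∧ g.det ≠ 0 ∧ (∀ i, (h i).det ≠ 0) ∧
        ∀ i, g * h i * B i * (g * h i).adjugate = (g * h i).det • A i := by
  choose V hinv hVk hVφ using hV
  choose P B hP hφP hB hAP using fun i =>
    exists_blockTriangular_of_invariant (hk i) (hinv i) (hVk i) (hVφ i)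
  let g := P ⟨0, hl⟩
  have hgu : IsUnit g.det := (hP ⟨0, hl⟩).isUnit
  have hgh : ∀ i, g * (g⁻¹ * P i) = P i := fun i => by
    rw [← mul_assoc, Matrix.mul_nonsing_inv _ hgu, one_mul]
  -- Both φ g and φ P_i are supported on the last coordinate, which forces the last row of g⁻¹ P_i
  -- to vanish off its last entry.
  refine ⟨g, fun i => g⁻¹ * P i, B, ⟨fun i a b ha hb => ?_, hB⟩, hP _, fun i => ?_, fun i => ?_⟩
  · have hsingle : ∀ c, c ≠ a → (φ ᵥ* g) c = 0 := fun c hc => hφP _ c (by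
      have := c.2; have := a.2; have : c.1 ≠ a.1 := fun h => hc (Fin.ext h); omega)
    have hne : (φ ᵥ* g) a ≠ 0 := fun h0 => hφ (Matrix.eq_zero_of_vecMul_eq_zero (hP ⟨0, hl⟩) (by
      funext c
      by_cases hc : c = a
      · rw [hc]; exact h0
      · exact hsingle c hc))
    have h1 := hφP i b hb
    rw [← hgh i, ← Matrix.vecMul_vecMul, Matrix.vecMul, dotProduct, Finset.sum_eq_single a
      (fun c _ hc => by rw [hsingle c hc, zero_mul]) (by simp)] at h1
    exact (mul_eq_zero.mp h1).resolve_left hne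
  · have := congrArg Matrix.det (hgh i)
    rw [Matrix.det_mul] at this
    exact right_ne_zero_of_mul (this ▸ hP i)
  · simp only [hgh]
    rw [← hAP i, mul_assoc, Matrix.mul_adjugate, Matrix.mul_smul, mul_one]

end

/-! ### Irreducibility along polynomial paths -/

section

open scoped Matrix

/-- Vanishing of a multihomogeneous polynomial may be tested on any choice of coordinates. -/
theorem IsMultihomogeneous.vanishesAt_iff_eval_eq_zero {n l : ℕ} {f : EntryPoly n l}
    (hf : IsMultihomogeneous f) {p : MatTuple n l} {A : Fin l → Matrix (Fin n) (Fin n) ℂ}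
    (hA : ∀ i, ∃ h : A i ≠ 0, Projectivization.mk ℂ (A i) h = p i) :
    VanishesAt f p ↔
      MvPolynomial.eval (fun x : Fin l × Fin n × Fin n => A x.1 x.2.1 x.2.2) f = 0 := by
  refine ⟨fun h => h A hA, fun h => (hf.vanishesAt_iff p).mpr ?_⟩
  have h1 : ∀ i, ∃ c : ℂ, c • A i = (p i).rep := by
    intro i
    obtain ⟨h0, h1⟩ := hA i
    rw [← (p i).mk_rep, eq_comm, Projectivization.mk_eq_mk_iff'] at h1
    exact h1
  choose c hc using h1
  obtain ⟨d, hd⟩ := hf.eval_smul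
  have := hd c A
  simp only [hc] at this
  rw [this, h, mul_zero]

/-- The affine-linear path from `M` at `0` to `N` at `1`. -/
noncomputable def Matrix.linePath {n : ℕ} (M N : Matrix (Fin n) (Fin n) ℂ) :
    Matrix (Fin n) (Fin n) (Polynomial ℂ) :=
  Matrix.of fun a b => Polynomial.C (M a b) * (1 - Polynomial.X) + Polynomial.C (N a b) *
    Polynomial.X

theorem Matrix.mapMatrix_linePath {n : ℕ} (M N : Matrix (Fin n) (Fin n) ℂ) (t : ℂ) :
    (Polynomial.evalRingHom t).mapMatrix (linePath M N) = (1 - t) • M + t • N := by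
  ext a b
  simp [linePath]
  ring

theorem IsFlagDatum.linePath {n l : ℕ} {k : Fin l → ℕ} {g g' : Matrix (Fin n) (Fin n) ℂ}
    {h B h' B' : Fin l → Matrix (Fin n) (Fin n) ℂ} (hd : IsFlagDatum k g h B)
    (hd' : IsFlagDatum k g' h' B') (t : ℂ) :
    IsFlagDatum k ((1 - t) • g + t • g') (fun i => (1 - t) • h i + t • h' i)
      (fun i => (1 - t) • B i + t • B' i) where
  row_eq_zero i a b ha hb := by simp [hd.row_eq_zero i a b ha hb, hd'.row_eq_zero i a b ha hb]
  block_eq_zero i a b ha hb := by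
    simp [hd.block_eq_zero i a b ha hb, hd'.block_eq_zero i a b ha hb]

/-- Any two points of `dependentTuples` lie on a polynomial path that stays in `dependentTuples`
except for finitely many parameters, the zeros of `D`. -/
theorem exists_path_dependentTuples {n l : ℕ} {k : Fin l → ℕ} (hl : 0 < l) (hk : ∀ i, k i < n)
    {p q : MatTuple n l} (hp : p ∈ dependentTuples n l k) (hq : q ∈ dependentTuples n l k) :
    ∃ (A : Fin l → Matrix (Fin n) (Fin n) (Polynomial ℂ)) (D : Polynomial ℂ), D ≠ 0 ∧
      (∀ i, ∃ h : (Polynomial.evalRingHom 0).mapMatrix (A i) ≠ 0,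
        Projectivization.mk ℂ _ h = p i) ∧
      (∀ i, ∃ h : (Polynomial.evalRingHom 1).mapMatrix (A i) ≠ 0,
        Projectivization.mk ℂ _ h = q i) ∧
      ∀ t, D.eval t ≠ 0 → ∃ r ∈ dependentTuples n l k,
        ∀ i, ∃ h : (Polynomial.evalRingHom t).mapMatrix (A i) ≠ 0,
          Projectivization.mk ℂ _ h = r i := by
  have hrep : ∀ (q : MatTuple n l) (i : Fin l),
      ∃ h : (q i).rep ≠ 0, Projectivization.mk ℂ (q i).rep h = q i :=
    fun q i => ⟨(q i).rep_nonzero, (q i).mk_rep⟩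
  have hn : 0 < n := (Nat.zero_le _).trans_lt (hk ⟨0, hl⟩)
  obtain ⟨φ, hφ, hV⟩ := (mem_dependentTuples_iff (hrep p)).mp hp
  obtain ⟨g, h, B, hd, hg, hh, hA⟩ := exists_isFlagDatum hl hk hφ hV
  obtain ⟨φ', hφ', hV'⟩ := (mem_dependentTuples_iff (hrep q)).mp hq
  obtain ⟨g', h', B', hd', hg', hh', hA'⟩ := exists_isFlagDatum hl hk hφ' hV'
  let G := Matrix.linePath g g'
  let H := fun i => Matrix.linePath (h i) (h' i)
  let A := fun i => G * H i * Matrix.linePath (B i) (B' i) * (G * H i).adjugate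
  have hAt : ∀ t i, (Polynomial.evalRingHom t).mapMatrix (A i) =
      ((1 - t) • g + t • g') * ((1 - t) • h i + t • h' i) * ((1 - t) • B i + t • B' i) *
        (((1 - t) • g + t • g') * ((1 - t) • h i + t • h' i)).adjugate := by
    intro t i
    simp only [A, G, H, map_mul, RingHom.map_adjugate, Matrix.mapMatrix_linePath]
  have hend : ∀ (M : Matrix (Fin n) (Fin n) ℂ) (x : Projectivization ℂ _) (c : ℂ), c ≠ 0 →
      M = c • x.rep → ∃ h : M ≠ 0, Projectivization.mk ℂ M h = x := by
    rintro M x c hc rfl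
    refine ⟨smul_ne_zero hc x.rep_nonzero, ?_⟩
    conv_rhs => rw [← x.mk_rep]
    exact (Projectivization.mk_eq_mk_iff' _ _ _ _ _).mpr ⟨c, rfl⟩
  have h0 : ∀ i, ∃ h : (Polynomial.evalRingHom 0).mapMatrix (A i) ≠ 0,
      Projectivization.mk ℂ _ h = p i := fun i =>
    hend _ _ (g * h i).det (by rw [Matrix.det_mul]; exact mul_ne_zero hg (hh i)) (by
      rw [hAt, ← hA]; simp)
  have h1 : ∀ i, ∃ h : (Polynomial.evalRingHom 1).mapMatrix (A i) ≠ 0,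
      Projectivization.mk ℂ _ h = q i := fun i =>
    hend _ _ (g' * h' i).det (by rw [Matrix.det_mul]; exact mul_ne_zero hg' (hh' i)) (by
      rw [hAt, ← hA']; simp)
  have hne : ∀ i, A i ≠ 0 := fun i hi => (h0 i).1 (by rw [hi, map_zero])
  have hentry : ∀ i, ∃ a b, A i a b ≠ 0 := fun i => by
    by_contra! hcon
    exact hne i (Matrix.ext hcon)
  choose a b hab using hentry
  have hGt : ∀ t, G.det.eval t = ((1 - t) • g + t • g').det := fun t => by
    rw [← Matrix.mapMatrix_linePath, ← RingHom.map_det]; rfl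
  have hHt : ∀ t i, (H i).det.eval t = ((1 - t) • h i + t • h' i).det := fun t i => by
    rw [← Matrix.mapMatrix_linePath, ← RingHom.map_det]; rfl
  -- The determinants keep the bases invertible; the chosen entries, nonzero as polynomials, keep
  -- each matrix nonzero and so a projective point.
  refine ⟨A, G.det * ∏ i, (H i).det * A i (a i) (b i), ?_, h0, h1, fun t ht => ?_⟩
  · refine mul_ne_zero (fun hG => hg ?_) (Finset.prod_ne_zero_iff.mpr fun i _ =>
      mul_ne_zero (fun hH => hh i ?_) (hab i))
    · have := hGt 0
      simpa [hG] using this.symm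
    · have := hHt 0 i
      simpa [hH] using this.symm
  · rw [Polynomial.eval_mul, Polynomial.eval_prod, mul_ne_zero_iff, Finset.prod_ne_zero_iff] at ht
    simp only [Polynomial.eval_mul, mul_ne_zero_iff] at ht
    obtain ⟨htG, htH⟩ := ht
    have hAne : ∀ i, (Polynomial.evalRingHom t).mapMatrix (A i) ≠ 0 := fun i hi =>
      (htH i (Finset.mem_univ i)).2 (congrFun (congrFun hi (a i)) (b i))
    refine ⟨fun i => Projectivization.mk ℂ _ (hAne i),
      (mem_dependentTuples_iff (A := fun i => (Polynomial.evalRingHom t).mapMatrix (A i))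
        fun i => ⟨hAne i, rfl⟩).mpr ?_, fun i => ⟨hAne i, rfl⟩⟩
    simp only [hAt]
    exact (hd.linePath hd' t).exists_invariant hk hn (hGt t ▸ htG)
      fun i => hHt t i ▸ (htH i (Finset.mem_univ i)).1

theorem nonempty_dependentTuples {n l : ℕ} {k : Fin l → ℕ} (hn : 0 < n) (hk : ∀ i, k i < n) :
    (dependentTuples n l k).Nonempty := by
  have : NeZero n := ⟨hn.ne'⟩
  refine ⟨fun _ => Projectivization.mk ℂ 1 one_ne_zero,
    (mem_dependentTuples_iff (A := fun _ => 1) fun i => ⟨one_ne_zero, rfl⟩).mpr ?_⟩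
  have hd : IsFlagDatum (K := ℂ) k (1 : Matrix (Fin n) (Fin n) ℂ) (fun _ => 1) (fun _ => 1) :=
    ⟨fun _ a b ha hb => Matrix.one_apply_ne (by rintro rfl; omega),
      fun _ a b hb ha => Matrix.one_apply_ne (by rintro rfl; omega)⟩
  simpa using hd.exists_invariant hk hn (by simp) (by simp)

theorem isClosed_zariski_iff {n l : ℕ} {Z : Set (MatTuple n l)} :
    @IsClosed _ (zariskiTopology n l) Z ↔ IsAlgebraicSet Z := by
  rw [← @isOpen_compl_iff _ _ (zariskiTopology n l)]
  change IsAlgebraicSet Zᶜᶜ ↔ _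
  rw [compl_compl]

theorem isPreirreducible_dependentTuples {n l : ℕ} {k : Fin l → ℕ} (hl : 0 < l)
    (hk : ∀ i, k i < n) :
    @IsPreirreducible _ (zariskiTopology n l) (dependentTuples n l k) := by
  intro U V hU hV hXU hXV
  obtain ⟨p, hp, hpU⟩ := hXU
  obtain ⟨q, hq, hqV⟩ := hXV
  have hopen : ∀ {W : Set (MatTuple n l)}, @IsOpen _ (zariskiTopology n l) W → ∀ p ∈ W,
      ∃ f, IsMultihomogeneous f ∧ ¬ VanishesAt f p ∧ ∀ r, ¬ VanishesAt f r → r ∈ W := by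
    intro W hW p hp
    obtain ⟨S, hS, hWS⟩ : IsAlgebraicSet Wᶜ := hW
    have hpS : p ∉ multiZeroLocus S := by rw [← hWS]; exact fun h => h hp
    simp only [multiZeroLocus, Set.mem_ofPred_eq, not_forall] at hpS
    obtain ⟨f, hf, hfp⟩ := hpS
    refine ⟨f, hS f hf, hfp, fun r hr => ?_⟩
    by_contra hrW
    have : r ∈ multiZeroLocus S := hWS ▸ hrW
    exact hr (this f hf)
  obtain ⟨f, hf, hfp, hfU⟩ := hopen hU p hpU
  obtain ⟨f', hf', hfq, hfV⟩ := hopen hV q hqV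
  obtain ⟨A, D, hD, h0, h1, hpath⟩ := exists_path_dependentTuples hl hk hp hq
  let F : EntryPoly n l → Polynomial ℂ := fun f =>
    MvPolynomial.aeval (fun x : Fin l × Fin n × Fin n => A x.1 x.2.1 x.2.2) f
  have hF : ∀ f t, (F f).eval t = MvPolynomial.eval (fun x : Fin l × Fin n × Fin n =>
      (Polynomial.evalRingHom t).mapMatrix (A x.1) x.2.1 x.2.2) f := by
    intro f t
    induction f using MvPolynomial.induction_on with
    | C c => simp [F]
    | add x y hx hy => simp only [F, map_add, Polynomial.eval_add] at *; rw [hx, hy]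
    | mul_X x i hx => simp only [F, map_mul, Polynomial.eval_mul] at *; rw [hx]; simp
  have hFp : F f ≠ 0 := fun h => hfp ((hf.vanishesAt_iff_eval_eq_zero h0).mpr (by
    rw [← hF, h, Polynomial.eval_zero]))
  have hFq : F f' ≠ 0 := fun h => hfq ((hf'.vanishesAt_iff_eval_eq_zero h1).mpr (by
    rw [← hF, h, Polynomial.eval_zero]))
  -- Each factor is a nonzero polynomial in t, and ℂ is infinite, so one parameter avoids all their
  -- zeros.
  obtain ⟨t, ht⟩ : ∃ t, (D * (F f * F f')).eval t ≠ 0 := by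
    by_contra! hcon
    exact mul_ne_zero hD (mul_ne_zero hFp hFq) (Polynomial.funext fun t => by
      rw [hcon, Polynomial.eval_zero])
  simp only [Polynomial.eval_mul, mul_ne_zero_iff] at ht
  obtain ⟨r, hr, hrA⟩ := hpath t ht.1
  exact ⟨r, hr, hfU r fun h => ht.2.1 (by rw [hF]; exact (hf.vanishesAt_iff_eval_eq_zero hrA).mp h),
    hfV r fun h => ht.2.2 (by rw [hF]; exact (hf'.vanishesAt_iff_eval_eq_zero hrA).mp h)⟩

end

theorem mainTheorem5 (n l : ℕ) (k : Fin l → ℕ) (hl : 2 ≤ l) (hk : ∀ i, 1 ≤ k i)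
    (hsum : ∑ i, k i = n) :
    IsIrreducibleProjectiveVariety (dependentTuples n l k) := by
  -- A second index j contributes k_j ≥ 1, so each V_i has room inside a hyperplane.
  have hlt : ∀ i, k i < n := by
    intro i
    have : Nontrivial (Fin l) := Fin.nontrivial_iff_two_le.mpr hl
    obtain ⟨j, hj⟩ := exists_ne i
    rw [← hsum]
    exact Finset.single_lt_sum hj (Finset.mem_univ i) (Finset.mem_univ j) (hk j)
      fun _ _ _ => Nat.zero_le _
  have hn : 0 < n := (Nat.zero_le _).trans_lt (hlt ⟨0, by omega⟩)
  exact ⟨isClosed_zariski_iff.mpr (isAlgebraicSet_dependentTuples fun i => (hlt i).le),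
    nonempty_dependentTuples hn hlt, isPreirreducible_dependentTuples (by omega) hlt⟩
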